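/- Let $\alpha=(\alpha_1,\ldots,\alpha_s)$ be a composition of $n=\alpha_1+\cdots+\alpha_s$ (all $\alpha_i$ positive integers). The fence poset $F(\alpha)$ is the poset on $x_1,\ldots,x_{n+1}$ whose order is generated by $$x_1\preceq \cdots\preceq x_{\alpha_1+1}\succeq x_{\alpha_1+2}\succeq\cdots\succeq x_{\alpha_1+\alpha_2+1}\preceq x_{\alpha_1+\alpha_2+2}\preceq\cdots\preceq x_{\alpha_1+\alpha_2+\alpha_3+1}\succeq\cdots .$$ The rank sequence of $\alpha$ is $r(\alpha)=(r_0,\ldots,r_{n+1})$, where $r_k$ is the number of lower ideals of $F(\alpha)$ with exactly $k$ elements. A sequence $(a_0,\ldots,a_N)$ is called symmetric if $a_i=a_{N-i}$ for all $i$; top interlacing if $a_0\le a_N\le a_1\le a_{N-1}\le\cdots\le a_{\lceil N/2\rceil}$; bottom interlacing if $a_N\le a_0\le a_{N-1}\le a_1\le\cdots\le a_{\lfloor N/2\rfloor}$. Theorem. (a) If $s=1$, then $r(\alpha)=(1,1,\ldots,1)$, which is symmetric. (b) If $s$ is even, then $r(\alpha)$ is bottom interlacing. (c) Suppose that $s\ge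 3$ is odd. (i) If $\alpha_1>\alpha_s$, then $r(\alpha)$ is bottom interlacing. (ii) If $\alpha_1<\alpha_s$, then $r(\alpha)$ is top interlacing. (iii) If $\alpha_1=\alpha_s$, then $r(\alpha)$ is symmetric, bottom interlacing, or top interlacing if and only if $r(\alpha_2,\ldots,\alpha_{s-1})$ is symmetric, top interlacing, or bottom interlacing, respectively. -/

import Mathlib

/-- The generating relations of the fence poset of a composition `c` of `n`, on the nodes
`x_0, …, x_n`. The edge `i` joins `x_i` and `x_{i+1}` and belongs to the part `c.index i`
(counted from `0`); it goes up if that part has an even index, and down otherwise. -/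
def FenceStep {n : ℕ} (c : Composition n) (x y : Fin (n + 1)) : Prop :=
  ∃ i : Fin n,
    (Even (c.index i : ℕ) ∧ x = i.castSucc ∧ y = i.succ) ∨
    (¬ Even (c.index i : ℕ) ∧ x = i.succ ∧ y = i.castSucc)

/-- Signed height of a node: up edges minus down edges to its left. It is only used to check
antisymmetry of the fence order. -/
def fenceHeight {n : ℕ} (c : Composition n) (x : Fin (n + 1)) : ℤ :=
  ∑ i : Fin n, if (i : ℕ) < (x : ℕ) then (if Even (c.index i : ℕ) then 1 else -1) else 0

theorem fenceHeight_succ {n : ℕ} (c : Composition n) (i : Fin n) :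
    fenceHeight c i.succ
      = fenceHeight c i.castSucc + (if Even (c.index i : ℕ) then 1 else -1) := by
  have h : (if Even (c.index i : ℕ) then (1 : ℤ) else -1)
      = ∑ j : Fin n, if j = i then (if Even (c.index j : ℕ) then (1 : ℤ) else -1) else 0 := by
    simp
  rw [h]
  unfold fenceHeight
  rw [← Finset.sum_add_distrib]
  refine Finset.sum_congr rfl fun j _ => ?_
  simp only [Fin.val_succ, Fin.val_castSucc, Fin.ext_iff]
  rcases lt_trichotomy (j : ℕ) (i : ℕ) with hj | hj | hj
  · simp [hj, hj.ne, Nat.lt_succ_of_lt hj]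
  · simp [hj]
  · simp [hj.ne', show ¬ (j : ℕ) < (i : ℕ) + 1 by omega, show ¬ (j : ℕ) < (i : ℕ) by omega]

theorem FenceStep.height_lt {n : ℕ} {c : Composition n} {x y : Fin (n + 1)}
    (h : FenceStep c x y) : fenceHeight c x < fenceHeight c y := by
  obtain ⟨i, ⟨he, rfl, rfl⟩ | ⟨he, rfl, rfl⟩⟩ := h
  · rw [fenceHeight_succ, if_pos he]; omega
  · rw [fenceHeight_succ, if_neg he]; omega

theorem fence_eq_or_height_lt {n : ℕ} {c : Composition n} {x y : Fin (n + 1)}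
    (h : Relation.ReflTransGen (FenceStep c) x y) :
    x = y ∨ fenceHeight c x < fenceHeight c y := by
  induction h with
  | refl => exact Or.inl rfl
  | tail _ hs ih =>
    right
    rcases ih with rfl | ih
    · exact hs.height_lt
    · exact ih.trans hs.height_lt

/-- The fence poset `F(c)` of a composition `c` of `n`: the `n + 1` nodes, ordered by the
reflexive transitive closure of the generating relations. -/
def Fence {n : ℕ} (_c : Composition n) : Type := Fin (n + 1)

instance Fence.instPartialOrder {n : ℕ} (c : Composition n) : PartialOrder (Fence c) where
  le := Relation.ReflTransGen (FenceStep c)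
  le_refl _ := Relation.ReflTransGen.refl
  le_trans _ _ _ h₁ h₂ := Relation.ReflTransGen.trans h₁ h₂
  le_antisymm x y h₁ h₂ := by
    rcases fence_eq_or_height_lt h₁ with h | h
    · exact h
    · rcases fence_eq_or_height_lt h₂ with h' | h'
      · exact h'.symm
      · exact absurd (h.trans h') (lt_irrefl _)

/-- The rank sequence `r(c)`: the entry of index `k` is the number of lower ideals of the fence
poset with exactly `k` elements. For a composition of `n` it is indexed by `0, …, n + 1`. -/
noncomputable def fenceRankSeq {n : ℕ} (c : Composition n) (k : ℕ) : ℕ :=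
  Nat.card {I : LowerSet (Fence c) // (I : Set (Fence c)).ncard = k}

/-- The sequence `a_0, …, a_N` is symmetric. -/
def SymmetricSeq (N : ℕ) (a : ℕ → ℕ) : Prop :=
  ∀ i, i ≤ N → a i = a (N - i)

/-- The sequence `a_0, …, a_N` satisfies `a_0 ≤ a_N ≤ a_1 ≤ a_{N-1} ≤ … ≤ a_{⌈N/2⌉}`. -/
def TopInterlacing (N : ℕ) (a : ℕ → ℕ) : Prop :=
  (∀ i, 2 * i < N → a i ≤ a (N - i)) ∧ (∀ i, 2 * i + 1 < N → a (N - i) ≤ a (i + 1))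

/-- The sequence `a_0, …, a_N` satisfies `a_N ≤ a_0 ≤ a_{N-1} ≤ a_1 ≤ … ≤ a_{⌊N/2⌋}`. -/
def BottomInterlacing (N : ℕ) (a : ℕ → ℕ) : Prop :=
  (∀ i, 2 * i < N → a (N - i) ≤ a i) ∧ (∀ i, 2 * i + 1 < N → a i ≤ a (N - (i + 1)))

/-- The composition `(α_2, …, α_{s-1})` obtained from `(α_1, …, α_s)` by deleting the first and
the last part. -/
def middleComposition {n : ℕ} (c : Composition n) :
    Composition c.blocks.tail.dropLast.sum where
  blocks := c.blocks.tail.dropLast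
  blocks_pos h := c.blocks_pos (List.mem_of_mem_tail (List.mem_of_mem_dropLast h))
  blocks_sum := rfl

/-! Encode a fence by the word of its edges. Reading the word edge by edge, its ideals are counted
by a product of 2 × 2 transfer matrices `fencePoly`. Exchanging up and down conjugates all these
matrices by one fixed matrix (`fencePoly_intertwining`), while complementation of ideals says that
the dual word has the reversed polynomials. Together they identify the asymmetry of the whole rank
sequence with that of the ideals that miss one end and contain the other (`fenceTotal_coeff_sub`),
and the asymmetry about the centre shifted by 1/2 with that of the ideals missing both ends.

Forced memberships shrink these families. Equal end edges can be stripped without changing the sign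
of the asymmetry. For a word starting up and ending down, the ideals containing the first node and
missing the last are, up to a shift, the ideals of a shorter fence, or a single one. That shorter
fence sits too far left to be balanced, so if its sequence decreases beyond its centre, the word is
left heavy. Induction on length gives heaviness and decrease together. The inequalities about the
shifted centre always hold, so bottom interlacing is left heaviness, top interlacing is right
heaviness, and symmetry is both.

For a composition, cancel equal amounts of the first and last runs. The remaining end edges differ
unless s is odd and the end parts are equal. In that case the middle word remains; it starts
downwards, so it is the dual of the fence of the middle composition, which swaps left and right. -/

open Polynomial in
/-- The generating polynomial, by cardinality, of the lower ideals of the fence whose edges are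
listed by a word (`true` is an up edge, `false` a down edge), where the membership of the first and
of the last node is prescribed. -/
noncomputable def fencePoly : List Bool → Bool → Bool → ℤ[X]
  | [], false, false => 1
  | [], true, true => X
  | [], false, true => 0
  | [], true, false => 0
  | true :: w, false, y => fencePoly w false y
  | true :: w, true, y => X * (fencePoly w false y + fencePoly w true y)
  | false :: w, false, y => fencePoly w false y + fencePoly w true y
  | false :: w, true, y => X * fencePoly w true y

/-- The generating polynomial of all lower ideals of the fence of a word. -/
noncomputable def fenceTotal (w : List Bool) : Polynomial ℤ :=
  fencePoly w false false + fencePoly w true false + fencePoly w false true + fencePoly w true true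

/-- The word of the dual fence. -/
def dualWord (w : List Bool) : List Bool := w.map not

@[simp] theorem dualWord_length (w : List Bool) : (dualWord w).length = w.length := by
  simp [dualWord]

@[simp] theorem dualWord_dualWord (w : List Bool) : dualWord (dualWord w) = w := by
  simp [dualWord, Function.comp_def]

@[simp] theorem dualWord_append (v w : List Bool) :
    dualWord (v ++ w) = dualWord v ++ dualWord w := by
  simp [dualWord]

@[simp] theorem dualWord_cons (e : Bool) (w : List Bool) :
    dualWord (e :: w) = (!e) :: dualWord w := rfl

@[simp] theorem dualWord_nil : dualWord [] = [] := rfl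

/-! ### Transfer matrices and duality. -/

section Algebra

open Polynomial

theorem fencePoly_append_up_false (w : List Bool) (x : Bool) :
    fencePoly (w ++ [true]) x false = fencePoly w x false + fencePoly w x true := by
  induction w generalizing x with
  | nil => cases x <;> simp [fencePoly]
  | cons e w ih => cases e <;> cases x <;> simp [fencePoly, ih] <;> ring

theorem fencePoly_append_up_true (w : List Bool) (x : Bool) :
    fencePoly (w ++ [true]) x true = X * fencePoly w x true := by
  induction w generalizing x with
  | nil => cases x <;> simp [fencePoly]
  | cons e w ih => cases e <;> cases x <;> simp [fencePoly, ih] <;> ring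

theorem fencePoly_append_down_false (w : List Bool) (x : Bool) :
    fencePoly (w ++ [false]) x false = fencePoly w x false := by
  induction w generalizing x with
  | nil => cases x <;> simp [fencePoly]
  | cons e w ih => cases e <;> cases x <;> simp [fencePoly, ih]

/-- The transfer matrices of a word and of its dual are conjugate, by one matrix for all words. -/
theorem fencePoly_intertwining (w : List Bool) :
    (fencePoly w true true + (1 - X) * fencePoly w false true
      = X * fencePoly (dualWord w) false false + (X - 1) * fencePoly (dualWord w) false true) ∧
    (fencePoly w true false + (1 - X) * fencePoly w false false
      = (1 - X) * fencePoly (dualWord w) false false + fencePoly (dualWord w) false true) ∧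
    ((X - 1) * fencePoly w true true + X * fencePoly w false true
      = X * fencePoly (dualWord w) true false + (X - 1) * fencePoly (dualWord w) true true) ∧
    ((X - 1) * fencePoly w true false + X * fencePoly w false false
      = (1 - X) * fencePoly (dualWord w) true false + fencePoly (dualWord w) true true) := by
  induction w with
  | nil => simp [fencePoly]
  | cons e w ih =>
    obtain ⟨h1, h2, h3, h4⟩ := ih
    cases e <;> simp only [fencePoly, dualWord_cons, Bool.not_true, Bool.not_false] <;>
      refine ⟨?_, ?_, ?_, ?_⟩
    · linear_combination h1
    · linear_combination h2
    · linear_combination X * h1 + X * h3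
    · linear_combination X * h2 + X * h4
    · linear_combination h1 + h3
    · linear_combination h2 + h4
    · linear_combination X * h3
    · linear_combination X * h4

/-- This is minus the determinant of the conjugating matrix. The intertwining relations can be
solved after multiplying by it, and it is then cancelled. -/
theorem cyclotomicSix_ne_zero : (X ^ 2 - X + 1 : ℤ[X]) ≠ 0 := by
  intro h
  have := congrArg (eval 0) h
  simp at this

theorem fenceTotal_sub_dual (w : List Bool) :
    fenceTotal w - fenceTotal (dualWord w)
      = fencePoly w false true - fencePoly (dualWord w) true false := by
  obtain ⟨h1, h2, h3, h4⟩ := fencePoly_intertwining w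
  apply mul_left_cancel₀ cyclotomicSix_ne_zero
  unfold fenceTotal
  linear_combination X * h1 + (X - 1) * h3 + h2 + X * h4

theorem X_mul_fenceTotal_add (w : List Bool) :
    X * fenceTotal w + fencePoly w false false
      = fenceTotal (dualWord w) + X * fencePoly (dualWord w) true true := by
  obtain ⟨h1, h2, h3, h4⟩ := fencePoly_intertwining w
  apply mul_left_cancel₀ cyclotomicSix_ne_zero
  unfold fenceTotal
  linear_combination X * h1 + X ^ 2 * h3 + h2 + (X ^ 2 + 1) * h4

end Algebra

/-! ### Coefficient identities for the asymmetries. -/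

section Coefficients

open Polynomial

theorem fencePoly_coeff_nonneg (w : List Bool) (x y : Bool) (k : ℕ) :
    0 ≤ (fencePoly w x y).coeff k := by
  induction w generalizing x k with
  | nil => cases x <;> cases y <;> simp [fencePoly, coeff_one, coeff_X] <;> split_ifs <;> simp
  | cons e w ih =>
    cases e <;> cases x <;> simp only [fencePoly, coeff_add, ih]
    · exact add_nonneg (ih _ _) (ih _ _)
    · cases k <;> simp [ih]
    · cases k
      · simp
      · simpa using add_nonneg (ih _ _) (ih _ _)

theorem fencePoly_coeff_eq_zero (w : List Bool) (x y : Bool) {k : ℕ} (hk : w.length + 1 < k) :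
    (fencePoly w x y).coeff k = 0 := by
  induction w generalizing x k with
  | nil =>
    simp only [List.length_nil] at hk
    cases x <;> cases y <;> simp [fencePoly, coeff_one, coeff_X] <;> omega
  | cons e w ih =>
    simp only [List.length_cons] at hk
    obtain ⟨k, rfl⟩ : ∃ j, k = j + 1 := ⟨k - 1, by omega⟩
    cases e <;> cases x <;> simp only [fencePoly, coeff_add, coeff_X_mul] <;>
      simp [ih _ (k := k) (by omega), ih _ (k := k + 1) (by omega)]

/-- The complement of a lower ideal is a lower ideal of the dual fence, with both end memberships
flipped; the fence has `w.length + 1` nodes. -/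
theorem fencePoly_coeff_dualWord (w : List Bool) (x y : Bool) {i j : ℕ}
    (hij : i + j = w.length + 1) :
    (fencePoly (dualWord w) (!x) (!y)).coeff i = (fencePoly w x y).coeff j := by
  induction w generalizing x i j with
  | nil =>
    simp only [List.length_nil, zero_add] at hij
    obtain ⟨rfl, rfl⟩ | ⟨rfl, rfl⟩ : i = 0 ∧ j = 1 ∨ i = 1 ∧ j = 0 := by omega
    all_goals cases x <;> cases y <;> simp [fencePoly, coeff_one, coeff_X]
  | cons e w ih =>
    simp only [List.length_cons] at hij
    have h0 : ∀ x, (fencePoly w x y).coeff (w.length + 2) = 0 :=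
      fun x => fencePoly_coeff_eq_zero w x y (by omega)
    have h1 : ∀ x, (fencePoly (dualWord w) x (!y)).coeff (w.length + 2) = 0 :=
      fun x => fencePoly_coeff_eq_zero (dualWord w) x _ (by simp)
    have ih' : ∀ x, ∀ {i j : ℕ}, i + j = w.length + 1 →
        (fencePoly (dualWord w) x (!y)).coeff i = (fencePoly w (!x) y).coeff j := by
      intro x i j h
      simpa using ih (!x) h
    have hi : i = 0 ∧ j = w.length + 2 ∨ ∃ k, i = k + 1 := by
      rcases i with _ | k
      · left; omega
      · exact Or.inr ⟨k, rfl⟩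
    have hj : j = 0 ∧ i = w.length + 2 ∨ ∃ k, j = k + 1 := by
      rcases j with _ | k
      · left; omega
      · exact Or.inr ⟨k, rfl⟩
    cases e <;> cases x <;>
      simp only [fencePoly, dualWord_cons, Bool.not_true, Bool.not_false, coeff_add]
    · rcases hi with ⟨rfl, rfl⟩ | ⟨k, rfl⟩
      · simp [h0]
      · simp [ih' _ (show k + j = w.length + 1 by omega)]; ring
    · rcases hj with ⟨rfl, rfl⟩ | ⟨k, rfl⟩
      · simp [h1]
      · simp [ih' _ (show i + k = w.length + 1 by omega)]
    · rcases hi with ⟨rfl, rfl⟩ | ⟨k, rfl⟩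
      · simp [h0]
      · simp [ih' _ (show k + j = w.length + 1 by omega)]
    · rcases hj with ⟨rfl, rfl⟩ | ⟨k, rfl⟩
      · simp [h1]
      · simp [ih' _ (show i + k = w.length + 1 by omega)]; ring

theorem fenceTotal_coeff_nonneg (w : List Bool) (k : ℕ) : 0 ≤ (fenceTotal w).coeff k := by
  simp only [fenceTotal, coeff_add]
  have := fencePoly_coeff_nonneg w
  linarith [this true true k, this true false k, this false true k, this false false k]

theorem fenceTotal_coeff_eq_zero (w : List Bool) {k : ℕ} (hk : w.length + 1 < k) :
    (fenceTotal w).coeff k = 0 := by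
  simp [fenceTotal, fencePoly_coeff_eq_zero w _ _ hk]

theorem fenceTotal_coeff_dualWord (w : List Bool) {i j : ℕ} (hij : i + j = w.length + 1) :
    (fenceTotal (dualWord w)).coeff i = (fenceTotal w).coeff j := by
  have h := fun x y => fencePoly_coeff_dualWord w x y hij
  have h1 := h true true
  have h2 := h true false
  have h3 := h false true
  have h4 := h false false
  simp only [Bool.not_true, Bool.not_false] at h1 h2 h3 h4
  simp only [fenceTotal, coeff_add, h1, h2, h3, h4]
  ring

/-- The asymmetry of the rank sequence is that of the ideals without the first and with the last
node. -/
theorem fenceTotal_coeff_sub (w : List Bool) {i j : ℕ} (hij : i + j = w.length + 1) :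
    (fenceTotal w).coeff i - (fenceTotal w).coeff j
      = (fencePoly w false true).coeff i - (fencePoly w false true).coeff j := by
  have h := congrArg (fun p => p.coeff i) (fenceTotal_sub_dual w)
  have h' := fencePoly_coeff_dualWord w false true hij
  simp only [Bool.not_true, Bool.not_false] at h'
  simpa only [coeff_sub, fenceTotal_coeff_dualWord w hij, h'] using h

/-- The asymmetry of the rank sequence is that of the ideals with the first and without the last
node. -/
theorem fenceTotal_coeff_sub' (w : List Bool) {i j : ℕ} (hij : i + j = w.length + 1) :
    (fenceTotal w).coeff i - (fenceTotal w).coeff j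
      = (fencePoly w true false).coeff i - (fencePoly w true false).coeff j := by
  have h := fenceTotal_coeff_sub (dualWord w) (i := j) (j := i) (by simp; omega)
  have h1 := fencePoly_coeff_dualWord w true false hij
  have h2 := fencePoly_coeff_dualWord w true false (i := j) (j := i) (by omega)
  simp only [Bool.not_true, Bool.not_false] at h1 h2
  rwa [h1, h2, fenceTotal_coeff_dualWord w hij,
    fenceTotal_coeff_dualWord w (i := j) (j := i) (by omega)] at h

/-- Entries placed symmetrically around the centre shifted by `1 / 2` differ by an asymmetry of
the ideals without the two ends. -/
theorem fenceTotal_coeff_sub_shift (w : List Bool) {i j : ℕ} (hij : i + j = w.length) :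
    (fenceTotal w).coeff j - (fenceTotal w).coeff i
      = (fencePoly w false false).coeff (i + 1) - (fencePoly w false false).coeff (j + 1) := by
  have h := congrArg (fun p => p.coeff (i + 1)) (X_mul_fenceTotal_add w)
  have h1 := fencePoly_coeff_dualWord w false false (i := i) (j := j + 1) (by omega)
  have h2 := fenceTotal_coeff_dualWord w (i := i + 1) (j := j) (by omega)
  simp only [Bool.not_false] at h1
  simp only [coeff_add, coeff_X_mul, h1, h2] at h
  linarith

end Coefficients

/-! ### Heaviness and decrease beyond the centre. -/

/-- The rank sequence of a word is at least as large on the left of its centre. -/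
def LeftHeavy (w : List Bool) : Prop :=
  ∀ i j, i + j = w.length + 1 → i ≤ j → (fenceTotal w).coeff j ≤ (fenceTotal w).coeff i

/-- The rank sequence of a word is at least as large on the right of its centre. -/
def RightHeavy (w : List Bool) : Prop :=
  ∀ i j, i + j = w.length + 1 → i ≤ j → (fenceTotal w).coeff i ≤ (fenceTotal w).coeff j

/-- The entries of a sequence on the right of `M / 2` are dominated by all strictly closer ones. -/
def DecreasingBeyond (M : ℕ) (p : Polynomial ℤ) : Prop :=
  ∀ i j, i < j → M < i + j → p.coeff j ≤ p.coeff i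

theorem decreasingBeyond_one (M : ℕ) : DecreasingBeyond M 1 := by
  intro i j hij _
  simp only [Polynomial.coeff_one]
  split_ifs <;> omega

theorem DecreasingBeyond.mono {M M' : ℕ} {p : Polynomial ℤ} (h : DecreasingBeyond M p)
    (hM : M ≤ M') : DecreasingBeyond M' p :=
  fun i j hij hM' => h i j hij (by omega)

theorem leftHeavy_dualWord {w : List Bool} : LeftHeavy (dualWord w) ↔ RightHeavy w := by
  constructor
  · intro h i j hij hle
    have := h i j (by simpa using hij) hle
    rwa [fenceTotal_coeff_dualWord w hij,
      fenceTotal_coeff_dualWord w (i := j) (j := i) (by omega)] at this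
  · intro h i j hij hle
    rw [dualWord_length] at hij
    rw [fenceTotal_coeff_dualWord w hij,
      fenceTotal_coeff_dualWord w (i := j) (j := i) (by omega)]
    exact h i j hij hle

theorem rightHeavy_dualWord {w : List Bool} : RightHeavy (dualWord w) ↔ LeftHeavy w := by
  rw [← leftHeavy_dualWord, dualWord_dualWord]

/-! ### The induction on the length of the word. -/

section Induction

open Polynomial

/-- These ideals miss the last node. A final down edge then excludes the previous node too, and can
be dropped; a final up edge leaves the rest of the fence free. If no up edge occurs, only the empty
ideal survives. -/
theorem fencePoly_add_eq_one_or (w : List Bool) :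
    fencePoly w false false + fencePoly w true false = 1 ∨
      ∃ v : List Bool, v.length < w.length ∧
        fencePoly w false false + fencePoly w true false = fenceTotal v := by
  induction w using List.reverseRecOn with
  | nil => simp [fencePoly]
  | append_singleton w e ih =>
    cases e
    · simp only [fencePoly_append_down_false]
      rcases ih with h | ⟨v, hv, h⟩
      · exact Or.inl h
      · exact Or.inr ⟨v, by simp; omega, h⟩
    · refine Or.inr ⟨w, by simp, ?_⟩
      simp only [fencePoly_append_up_false, fenceTotal]
      ring

/-- The same stripping at the front: initial up edges propagate the absence of the first node, and
the first down edge frees the next node. -/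
theorem fencePoly_false_false_eq_one_or (w : List Bool) :
    fencePoly w false false = 1 ∨
      ∃ v : List Bool, v.length < w.length ∧ fencePoly w false false = fenceTotal v := by
  induction w with
  | nil => simp [fencePoly]
  | cons e w ih =>
    cases e
    · rcases fencePoly_add_eq_one_or w with h | ⟨v, hv, h⟩
      · exact Or.inl h
      · exact Or.inr ⟨v, by simp; omega, h⟩
    · rcases ih with h | ⟨v, hv, h⟩
      · exact Or.inl h
      · exact Or.inr ⟨v, by simp; omega, h⟩

/-- If the first node is missing and the last is present, the outer up edges force the same at the
ends of `w`, so the relevant ideals are those of `w` with one node added. -/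
theorem fenceTotal_coeff_up_up (w : List Bool) {i j : ℕ} (hij : i + j = w.length + 1) :
    (fenceTotal (true :: (w ++ [true]))).coeff (i + 1)
        - (fenceTotal (true :: (w ++ [true]))).coeff (j + 1)
      = (fenceTotal w).coeff i - (fenceTotal w).coeff j := by
  rw [fenceTotal_coeff_sub w hij, fenceTotal_coeff_sub _ (by simp; omega)]
  simp [fencePoly, fencePoly_append_up_true]

theorem fenceTotal_coeff_up_up_ends (w : List Bool) :
    (fenceTotal (true :: (w ++ [true]))).coeff 0
      = (fenceTotal (true :: (w ++ [true]))).coeff (w.length + 3) := by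
  rw [← sub_eq_zero, fenceTotal_coeff_sub _ (by simp)]
  simp [fencePoly, fencePoly_append_up_true, fencePoly_coeff_eq_zero]

theorem leftHeavy_up_up {w : List Bool} : LeftHeavy (true :: (w ++ [true])) ↔ LeftHeavy w := by
  constructor
  · intro h i j hij hle
    have := h (i + 1) (j + 1) (by simp; omega) (by omega)
    linarith [fenceTotal_coeff_up_up w hij]
  · intro h i j hij hle
    simp only [List.length_cons, List.length_append, List.length_nil] at hij
    rcases i with _ | i
    · obtain rfl : j = w.length + 3 := by omega
      exact (fenceTotal_coeff_up_up_ends w).ge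
    · obtain ⟨j, rfl⟩ : ∃ k, j = k + 1 := ⟨j - 1, by omega⟩
      have := h i j (by omega) (by omega)
      linarith [fenceTotal_coeff_up_up w (i := i) (j := j) (by omega)]

theorem rightHeavy_up_up {w : List Bool} :
    RightHeavy (true :: (w ++ [true])) ↔ RightHeavy w := by
  constructor
  · intro h i j hij hle
    have := h (i + 1) (j + 1) (by simp; omega) (by omega)
    linarith [fenceTotal_coeff_up_up w hij]
  · intro h i j hij hle
    simp only [List.length_cons, List.length_append, List.length_nil] at hij
    rcases i with _ | i
    · obtain rfl : j = w.length + 3 := by omega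
      exact (fenceTotal_coeff_up_up_ends w).le
    · obtain ⟨j, rfl⟩ : ∃ k, j = k + 1 := ⟨j - 1, by omega⟩
      have := h i j (by omega) (by omega)
      linarith [fenceTotal_coeff_up_up w (i := i) (j := j) (by omega)]

theorem leftHeavy_down_down {w : List Bool} :
    LeftHeavy (false :: (w ++ [false])) ↔ LeftHeavy w := by
  rw [← rightHeavy_dualWord, ← rightHeavy_dualWord]
  simpa using rightHeavy_up_up (w := dualWord w)

theorem rightHeavy_down_down {w : List Bool} :
    RightHeavy (false :: (w ++ [false])) ↔ RightHeavy w := by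
  rw [← leftHeavy_dualWord, ← leftHeavy_dualWord]
  simpa using leftHeavy_up_up (w := dualWord w)

theorem leftHeavy_nil : LeftHeavy [] := by
  intro i j hij hle
  obtain ⟨rfl, rfl⟩ : i = 0 ∧ j = 1 := by simp at hij; omega
  simp [fenceTotal, fencePoly, coeff_one, coeff_X]

theorem leftHeavy_singleton (e : Bool) : LeftHeavy [e] := by
  intro i j hij hle
  obtain ⟨rfl, rfl⟩ | ⟨rfl, rfl⟩ : i = 0 ∧ j = 2 ∨ i = 1 ∧ j = 1 := by simp at hij; omega
  all_goals cases e <;> simp [fenceTotal, fencePoly, coeff_one, coeff_X, ← pow_two, coeff_X_pow]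

theorem leftHeavy_up_down {w : List Bool}
    (h : ∀ v : List Bool, v.length < w.length → DecreasingBeyond (v.length + 1) (fenceTotal v)) :
    LeftHeavy (true :: (w ++ [false])) := by
  intro i j hij hle
  have key := fenceTotal_coeff_sub' _ hij
  simp only [fencePoly, fencePoly_append_down_false] at key
  simp only [List.length_cons, List.length_append, List.length_nil] at hij
  -- The shorter fence has centre at most `w.length / 2`, whereas after removing the factor `X` the
  -- two indices compared sum to `w.length + 1`.
  have hd : DecreasingBeyond w.length (fencePoly w false false + fencePoly w true false) := by
    rcases fencePoly_add_eq_one_or w with h1 | ⟨v, hv, h1⟩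
    · exact h1 ▸ decreasingBeyond_one _
    · exact h1 ▸ (h v hv).mono hv
  rcases i with _ | i
  · obtain rfl : j = w.length + 3 := by omega
    simp [fencePoly_coeff_eq_zero] at key
    linarith
  · obtain ⟨j, rfl⟩ : ∃ k, j = k + 1 := ⟨j - 1, by omega⟩
    rcases hle.eq_or_lt with heq | hlt
    · rw [heq]
    · have := hd i j (by omega) (by omega)
      simp only [coeff_X_mul] at key
      linarith

theorem rightHeavy_down_up {w : List Bool}
    (h : ∀ v : List Bool, v.length < w.length → DecreasingBeyond (v.length + 1) (fenceTotal v)) :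
    RightHeavy (false :: (w ++ [true])) := by
  rw [← leftHeavy_dualWord]
  simpa using leftHeavy_up_down (w := dualWord w) (by simpa using h)

theorem fenceTotal_coeff_le_shift {w : List Bool}
    (h : ∀ v : List Bool, v.length < w.length → DecreasingBeyond (v.length + 1) (fenceTotal v))
    {i j : ℕ} (hij : i + j = w.length) (hle : i ≤ j) :
    (fenceTotal w).coeff i ≤ (fenceTotal w).coeff j := by
  have hd : DecreasingBeyond w.length (fencePoly w false false) := by
    rcases fencePoly_false_false_eq_one_or w with h1 | ⟨v, hv, h1⟩
    · exact h1 ▸ decreasingBeyond_one _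
    · exact h1 ▸ (h v hv).mono hv
  rcases hle.eq_or_lt with heq | hlt
  · rw [heq]
  · linarith [hd (i + 1) (j + 1) (by omega) (by omega), fenceTotal_coeff_sub_shift w hij]

/-- The previous inequality for the dual word; index `0` is paired with an entry beyond the last
one, which is zero. -/
theorem fenceTotal_coeff_ge_shift {w : List Bool}
    (h : ∀ v : List Bool, v.length < w.length → DecreasingBeyond (v.length + 1) (fenceTotal v))
    {i j : ℕ} (hij : i + j = w.length + 2) (hle : i ≤ j) :
    (fenceTotal w).coeff j ≤ (fenceTotal w).coeff i := by
  rcases i with _ | i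
  · rw [fenceTotal_coeff_eq_zero w (by omega)]
    exact fenceTotal_coeff_nonneg _ _
  · obtain ⟨j, rfl⟩ : ∃ k, j = k + 1 := ⟨j - 1, by omega⟩
    have := fenceTotal_coeff_le_shift (w := dualWord w) (by simpa using h) (i := i) (j := j)
      (by simp; omega) (by omega)
    rwa [fenceTotal_coeff_dualWord w (i := i) (j := j + 1) (by omega),
      fenceTotal_coeff_dualWord w (i := j) (j := i + 1) (by omega)] at this

/-- Beyond the centre a rank sequence of a fence is dominated by its strictly closer entries. -/
theorem decreasingBeyond_of_heavy {w : List Bool}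
    (h : ∀ v : List Bool, v.length < w.length → DecreasingBeyond (v.length + 1) (fenceTotal v))
    (hw : LeftHeavy w ∨ RightHeavy w) :
    DecreasingBeyond (w.length + 1) (fenceTotal w) := by
  have h1 := fun {i j : ℕ} => fenceTotal_coeff_le_shift h (i := i) (j := j)
  have h2 := fun {i j : ℕ} => fenceTotal_coeff_ge_shift h (i := i) (j := j)
  -- consecutive entries decrease beyond the centre
  have h3 : ∀ j, w.length + 1 ≤ 2 * j → j ≤ w.length →
      (fenceTotal w).coeff (j + 1) ≤ (fenceTotal w).coeff j := by
    intro j hj hjl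
    obtain ⟨i, hi⟩ : ∃ i, i + (j + 1) = w.length + 1 := ⟨w.length - j, by omega⟩
    -- The comparison of neighbours passes through a reflected entry: one inequality is heaviness,
    -- the other is the one about a centre shifted by 1/2.
    rcases hw with hw | hw
    · exact (hw i (j + 1) hi (by omega)).trans (h1 (by omega) (by omega))
    · exact (h2 (i := i + 1) (j := j + 1) (by omega) (by omega)).trans
        (hw (i + 1) j (by omega) (by omega))
  intro i j
  induction j with
  | zero => intro hij; omega
  | succ j ih =>
    intro hij hN
    rcases Nat.lt_or_ge (w.length + 1) (j + 1) with hj | hj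
    · rw [fenceTotal_coeff_eq_zero w hj]
      exact fenceTotal_coeff_nonneg _ _
    -- When the index sum exceeds `w.length + 2`, lowering `j + 1` to `j` stays beyond the centre;
    -- the remaining sum is exactly `w.length + 2`.
    · rcases Nat.lt_or_ge (w.length + 2) (i + (j + 1)) with hs | hs
      · rcases (Nat.lt_succ_iff.mp hij).eq_or_lt with heq | hlt
        · rw [heq]; exact h3 j (by omega) (by omega)
        · exact (h3 j (by omega) (by omega)).trans (ih hlt (by omega))
      · exact h2 (by omega) (by omega)

theorem leftHeavy_or_rightHeavy_and_decreasingBeyond (w : List Bool) :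
    (LeftHeavy w ∨ RightHeavy w) ∧ DecreasingBeyond (w.length + 1) (fenceTotal w) := by
  induction hn : w.length using Nat.strong_induction_on generalizing w with
  | _ n ih =>
    subst hn
    have ih' : ∀ v : List Bool, v.length < w.length →
        DecreasingBeyond (v.length + 1) (fenceTotal v) := fun v hv => (ih _ hv v rfl).2
    suffices h : LeftHeavy w ∨ RightHeavy w from ⟨h, decreasingBeyond_of_heavy ih' h⟩
    match w with
    | [] => exact Or.inl leftHeavy_nil
    | e :: w =>
      rcases List.eq_nil_or_concat' w with rfl | ⟨v, e', rfl⟩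
      · exact Or.inl (leftHeavy_singleton e)
      · have hv := (ih v.length (by simp) v rfl).1
        have ihv : ∀ u : List Bool, u.length < v.length →
            DecreasingBeyond (u.length + 1) (fenceTotal u) :=
          fun u hu => ih' u (by simp; omega)
        cases e <;> cases e'
        · rwa [leftHeavy_down_down, rightHeavy_down_down]
        · exact Or.inr (rightHeavy_down_up ihv)
        · exact Or.inl (leftHeavy_up_down ihv)
        · rwa [leftHeavy_up_up, rightHeavy_up_up]

theorem decreasingBeyond_fenceTotal (w : List Bool) :
    DecreasingBeyond (w.length + 1) (fenceTotal w) :=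
  (leftHeavy_or_rightHeavy_and_decreasingBeyond w).2

end Induction

/-! ### Interlacing as heaviness. -/

section Interlacing

variable {w : List Bool} {a : ℕ → ℕ}

theorem bottomInterlacing_iff_leftHeavy (ha : ∀ k, (a k : ℤ) = (fenceTotal w).coeff k) :
    BottomInterlacing (w.length + 1) a ↔ LeftHeavy w := by
  constructor
  · intro h i j hij hle
    rcases hle.eq_or_lt with rfl | hlt
    · rfl
    · have := h.1 i (by omega)
      rw [show w.length + 1 - i = j by omega] at this
      rw [← ha, ← ha]
      exact_mod_cast this
  · intro h
    refine ⟨fun i hi => ?_, fun i hi => ?_⟩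
    · have := h i (w.length + 1 - i) (by omega) (by omega)
      rw [← ha, ← ha] at this
      exact_mod_cast this
    -- These inequalities hold for every word, so only the other half of the interlacing carries
    -- information.
    · have := fenceTotal_coeff_le_shift (w := w) (fun v _ => decreasingBeyond_fenceTotal v)
        (i := i) (j := w.length + 1 - (i + 1)) (by omega) (by omega)
      rw [← ha, ← ha] at this
      exact_mod_cast this

theorem topInterlacing_iff_rightHeavy (ha : ∀ k, (a k : ℤ) = (fenceTotal w).coeff k) :
    TopInterlacing (w.length + 1) a ↔ RightHeavy w := by
  constructor
  · intro h i j hij hle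
    rcases hle.eq_or_lt with rfl | hlt
    · rfl
    · have := h.1 i (by omega)
      rw [show w.length + 1 - i = j by omega] at this
      rw [← ha, ← ha]
      exact_mod_cast this
  · intro h
    refine ⟨fun i hi => ?_, fun i hi => ?_⟩
    · have := h i (w.length + 1 - i) (by omega) (by omega)
      rw [← ha, ← ha] at this
      exact_mod_cast this
    · have := fenceTotal_coeff_ge_shift (w := w) (fun v _ => decreasingBeyond_fenceTotal v)
        (i := i + 1) (j := w.length + 1 - i) (by omega) (by omega)
      rw [← ha, ← ha] at this
      exact_mod_cast this

theorem symmetricSeq_iff (ha : ∀ k, (a k : ℤ) = (fenceTotal w).coeff k) :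
    SymmetricSeq (w.length + 1) a ↔ LeftHeavy w ∧ RightHeavy w := by
  constructor
  · intro h
    have key : ∀ i j, i + j = w.length + 1 → (fenceTotal w).coeff i = (fenceTotal w).coeff j := by
      intro i j hij
      have := h i (by omega)
      rw [show w.length + 1 - i = j by omega] at this
      rw [← ha, ← ha, this]
    exact ⟨fun i j hij _ => (key i j hij).ge, fun i j hij _ => (key i j hij).le⟩
  · rintro ⟨hl, hr⟩ i hi
    have key : (fenceTotal w).coeff i = (fenceTotal w).coeff (w.length + 1 - i) := by
      rcases Nat.le_total i (w.length + 1 - i) with h | h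
      · exact le_antisymm (hr _ _ (by omega) h) (hl _ _ (by omega) h)
      · exact le_antisymm (hl _ _ (by omega) h) (hr _ _ (by omega) h)
    rw [← ha, ← ha] at key
    exact_mod_cast key

end Interlacing

/-! ### Words of compositions. -/

section BlockWord

/-- The word whose maximal runs have the given lengths, alternating between up and down edges. -/
def blockWord : Bool → List ℕ → List Bool
  | _, [] => []
  | e, a :: l => List.replicate a e ++ blockWord (!e) l

@[simp] theorem blockWord_length (e : Bool) (l : List ℕ) : (blockWord e l).length = l.sum := by
  induction l generalizing e with
  | nil => rfl
  | cons a l ih => simp [blockWord, ih]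

theorem dualWord_blockWord (e : Bool) (l : List ℕ) :
    dualWord (blockWord e l) = blockWord (!e) l := by
  induction l generalizing e with
  | nil => rfl
  | cons a l ih => simpa [blockWord, dualWord] using ih (!e)

theorem blockWord_append_singleton (e : Bool) (l : List ℕ) (b : ℕ) :
    blockWord e (l ++ [b])
      = blockWord e l ++ List.replicate b (e ^^ decide (Odd l.length)) := by
  induction l generalizing e with
  | nil => simp [blockWord]
  | cons a l ih =>
    simp only [List.cons_append, blockWord, ih, List.append_assoc, List.length_cons,
      Nat.odd_add_one]
    by_cases h : Odd l.length <;> simp [h]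

theorem blockWord_getElem? (e : Bool) (l : List ℕ) (j k : ℕ) (h1 : (l.take k).sum ≤ j)
    (h2 : j < (l.take (k + 1)).sum) :
    (blockWord e l)[j]? = some (e ^^ decide (Odd k)) := by
  induction l generalizing e j k with
  | nil => simp at h2
  | cons a l ih =>
    rcases k with _ | k
    · simp at h2
      simp [blockWord, List.getElem?_append_left, h2]
    · simp only [List.take_succ_cons, List.sum_cons] at h1 h2
      rw [blockWord, List.getElem?_append_right (by simp; omega), List.length_replicate,
        ih _ (j - a) k (by omega) (by omega)]
      by_cases h : Odd k <;> simp [h, Nat.odd_add_one]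

theorem ofFn_even_index {n : ℕ} (c : Composition n) :
    List.ofFn (fun i : Fin n => decide (Even (c.index i : ℕ))) = blockWord true c.blocks := by
  apply List.ext_getElem
  · simp [c.blocks_sum]
  · intro j h1 h2
    have hj : j < n := by simpa using h1
    have := blockWord_getElem? true c.blocks j (c.index ⟨j, hj⟩)
      (c.sizeUpTo_index_le ⟨j, hj⟩) (c.lt_sizeUpTo_index_succ ⟨j, hj⟩)
    rw [List.getElem?_eq_getElem h2, Option.some_inj] at this
    by_cases h : Even (c.index ⟨j, hj⟩ : ℕ) <;> simp [this, h, ← Nat.not_even_iff_odd]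

end BlockWord

/-! ### Lower ideals counted by the transfer matrices. -/

section Counting

open Polynomial

/-- A membership vector on the nodes of a fence describes a lower ideal. -/
def IsIdealVector {n : ℕ} (e : Fin n → Bool) (b : Fin (n + 1) → Bool) : Prop :=
  ∀ i, if e i then b i.succ ≤ b i.castSucc else b i.castSucc ≤ b i.succ

instance {n : ℕ} (e : Fin n → Bool) : DecidablePred (IsIdealVector e) := fun _ =>
  inferInstanceAs (Decidable (∀ _, _))

theorem isIdealVector_cons {n : ℕ} (e : Fin (n + 1) → Bool) (x : Bool) (b : Fin (n + 1) → Bool) :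
    IsIdealVector e (Fin.cons x b) ↔
      (if e 0 then b 0 ≤ x else x ≤ b 0) ∧ IsIdealVector (fun i => e i.succ) b := by
  simp [IsIdealVector, Fin.forall_fin_succ]

/-- The number of nodes of a membership vector. -/
def vectorCard {n : ℕ} (b : Fin n → Bool) : ℕ := ∑ i, (b i).toNat

theorem vectorCard_cons {n : ℕ} (x : Bool) (b : Fin n → Bool) :
    vectorCard (Fin.cons x b : Fin (n + 1) → Bool) = x.toNat + vectorCard b := by
  simp [vectorCard, Fin.sum_univ_succ]

theorem ncard_eq_vectorCard {n : ℕ} (b : Fin n → Bool) :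
    Set.ncard {x | b x = true} = vectorCard b := by
  rw [Set.ncard_eq_toFinset_card', Set.toFinset_ofPred, Finset.card_filter]
  exact Finset.sum_congr rfl fun x _ => by cases b x <;> rfl

theorem sum_isIdealVector_cons {n : ℕ} (e : Fin n → Bool) (x : Bool) :
    (∑ b : Fin n → Bool, if IsIdealVector e (Fin.cons x b) then
        (X : ℤ[X]) ^ vectorCard (Fin.cons x b : Fin (n + 1) → Bool) else 0)
      = fencePoly (List.ofFn e) x false + fencePoly (List.ofFn e) x true := by
  induction n generalizing x with
  | zero => cases x <;> simp [IsIdealVector, vectorCard, fencePoly]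
  | succ n ih =>
    rw [← (Fin.consEquiv (fun _ : Fin (n + 1) => Bool)).sum_comp, Fintype.sum_prod_type]
    have key : ∀ y : Bool, (∑ b : Fin n → Bool,
        if IsIdealVector e (Fin.cons x (Fin.cons y b : Fin (n + 1) → Bool)) then
        (X : ℤ[X]) ^ vectorCard (Fin.cons x (Fin.cons y b : Fin (n + 1) → Bool) :
          Fin (n + 2) → Bool) else 0)
        = if (if e 0 then y ≤ x else x ≤ y) then X ^ x.toNat *
          (fencePoly (List.ofFn fun i => e i.succ) y false
            + fencePoly (List.ofFn fun i => e i.succ) y true) else 0 := by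
      intro y
      by_cases h : if e 0 then y ≤ x else x ≤ y
      · rw [if_pos h, ← ih, Finset.mul_sum]
        refine Finset.sum_congr rfl fun b _ => ?_
        simp only [isIdealVector_cons e, Fin.cons_zero, h, true_and, vectorCard_cons x, pow_add,
          mul_ite, mul_zero]
      · rw [if_neg h]
        refine Finset.sum_eq_zero fun b _ => ?_
        simp only [isIdealVector_cons e, Fin.cons_zero, h, false_and, if_false]
    simp only [Fintype.sum_bool]
    erw [key, key]
    rw [List.ofFn_succ]
    have hlt : ¬ true ≤ false := by decide
    cases h : e 0 <;> cases x <;> simp [fencePoly, hlt] <;> ring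

theorem sum_isIdealVector {n : ℕ} (e : Fin n → Bool) :
    (∑ b : Fin (n + 1) → Bool, if IsIdealVector e b then (X : ℤ[X]) ^ vectorCard b else 0)
      = fenceTotal (List.ofFn e) := by
  rw [← (Fin.consEquiv (fun _ : Fin (n + 1) => Bool)).sum_comp, Fintype.sum_prod_type]
  simp only [Fintype.sum_bool]
  erw [sum_isIdealVector_cons, sum_isIdealVector_cons]
  unfold fenceTotal
  ring

theorem isIdealVector_iff {n : ℕ} (c : Composition n) (b : Fin (n + 1) → Bool) :
    IsIdealVector (fun i => decide (Even (c.index i : ℕ))) b ↔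
      ∀ x y, FenceStep c x y → b y = true → b x = true := by
  simp only [IsIdealVector, Bool.le_iff_imp, decide_eq_true_eq]
  constructor
  · rintro h x y ⟨i, ⟨he, rfl, rfl⟩ | ⟨he, rfl, rfl⟩⟩
    · simpa [he] using h i
    · simpa [he] using h i
  · intro h i
    split_ifs with he
    · exact h _ _ ⟨i, Or.inl ⟨he, rfl, rfl⟩⟩
    · exact h _ _ ⟨i, Or.inr ⟨he, rfl, rfl⟩⟩

open Classical in
/-- The lower ideals of a fence as membership vectors. -/
noncomputable def lowerSetEquivVector {n : ℕ} (c : Composition n) :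
    LowerSet (Fence c) ≃
      {b : Fin (n + 1) → Bool // IsIdealVector (fun i => decide (Even (c.index i : ℕ))) b} where
  toFun I := ⟨fun x : Fence c => decide (x ∈ I), by
    refine (isIdealVector_iff c _).2 fun x y hxy hy => ?_
    simp only [decide_eq_true_eq] at hy ⊢
    exact I.lower (Relation.ReflTransGen.single hxy) hy⟩
  invFun b := ⟨{x : Fence c | b.1 x = true}, by
    intro y x hxy hy
    have hstep := (isIdealVector_iff c b.1).1 b.2
    have hxy' : Relation.ReflTransGen (FenceStep c) x y := hxy
    clear hxy
    induction hxy' with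
    | refl => exact hy
    | tail _ hs ih => exact ih (hstep _ _ hs hy)⟩
  left_inv I := by
    ext x
    exact decide_eq_true_iff
  right_inv b := by
    ext x
    exact Bool.decide_eq_true

theorem vectorCard_lowerSetEquivVector {n : ℕ} (c : Composition n) (I : LowerSet (Fence c)) :
    vectorCard (lowerSetEquivVector c I).1 = (I : Set (Fence c)).ncard := by
  rw [← ncard_eq_vectorCard]
  refine congrArg Set.ncard (Set.ext fun x => ?_)
  exact @decide_eq_true_iff _ (Classical.propDecidable _)

theorem fenceRankSeq_eq_coeff {n : ℕ} (c : Composition n) (k : ℕ) :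
    (fenceRankSeq c k : ℤ) = (fenceTotal (blockWord true c.blocks)).coeff k := by
  have hcard : fenceRankSeq c k = Nat.card {b : Fin (n + 1) → Bool //
      IsIdealVector (fun i => decide (Even (c.index i : ℕ))) b ∧ vectorCard b = k} :=
    Nat.card_congr <| ((lowerSetEquivVector c).subtypeEquiv
      (fun I => by rw [vectorCard_lowerSetEquivVector])).trans
      (Equiv.subtypeSubtypeEquivSubtypeInter _ fun b => vectorCard b = k)
  rw [hcard, ← ofFn_even_index,
    ← sum_isIdealVector, Nat.card_eq_fintype_card, Fintype.card_subtype, finsetSum_coeff,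
    Finset.card_filter]
  push_cast
  refine Finset.sum_congr rfl fun b _ => ?_
  by_cases h : IsIdealVector (fun i => decide (Even (c.index i : ℕ))) b
  · simp [h, coeff_X_pow, eq_comm]
  · simp [h]

end Counting

/-! ### End runs of a composition. -/

section Compositions

theorem blockWord_middle (e : Bool) (a b : ℕ) (m : List ℕ) (hm : Odd m.length) :
    blockWord e (a :: (m ++ [b]))
      = List.replicate a e ++ blockWord (!e) m ++ List.replicate b e := by
  simp [blockWord, blockWord_append_singleton, hm]

theorem heavy_replicate_up (a : ℕ) (w : List Bool) :
    (LeftHeavy (List.replicate a true ++ w ++ List.replicate a true) ↔ LeftHeavy w) ∧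
    (RightHeavy (List.replicate a true ++ w ++ List.replicate a true) ↔ RightHeavy w) := by
  induction a with
  | zero => simp
  | succ a ih =>
    have h : List.replicate (a + 1) true ++ w ++ List.replicate (a + 1) true
        = true :: ((List.replicate a true ++ w ++ List.replicate a true) ++ [true]) := by
      nth_rewrite 2 [List.replicate_succ']
      simp [List.replicate_succ]
    rw [h, leftHeavy_up_up, rightHeavy_up_up]
    exact ih

theorem leftHeavy_of_ends (w : List Bool) : LeftHeavy (true :: (w ++ [false])) :=
  leftHeavy_up_down fun v _ => decreasingBeyond_fenceTotal v

theorem fencePoly_replicate_up (n : ℕ) :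
    fencePoly (List.replicate n true) false false
      + fencePoly (List.replicate n true) false true = 1 := by
  induction n with
  | zero => simp [fencePoly]
  | succ n ih => simpa [List.replicate_succ, fencePoly] using ih

theorem fenceTotal_replicate_up (n : ℕ) (k : ℕ) (hk : k ≤ n + 1) :
    (fenceTotal (List.replicate n true)).coeff k = 1 := by
  induction n generalizing k with
  | zero =>
    obtain rfl | rfl : k = 0 ∨ k = 1 := by omega
    all_goals simp [fenceTotal, fencePoly, Polynomial.coeff_one, Polynomial.coeff_X]
  | succ n ih =>
    have h : fenceTotal (List.replicate (n + 1) true)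
        = 1 + Polynomial.X * fenceTotal (List.replicate n true) := by
      rw [← fencePoly_replicate_up n, List.replicate_succ]
      simp only [fenceTotal, fencePoly]
      ring
    rw [h, Polynomial.coeff_add]
    rcases k with _ | k
    · simp
    · rw [Polynomial.coeff_X_mul, ih k (by omega)]
      simp [Polynomial.coeff_one]

theorem leftHeavy_replicate_append {a b : ℕ} (ha : 0 < a) (hb : 0 < b) (w : List Bool) :
    LeftHeavy (List.replicate a true ++ w ++ List.replicate b false) := by
  obtain ⟨a, rfl⟩ : ∃ k, a = k + 1 := ⟨a - 1, by omega⟩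
  obtain ⟨b, rfl⟩ : ∃ k, b = k + 1 := ⟨b - 1, by omega⟩
  have := leftHeavy_of_ends (List.replicate a true ++ w ++ List.replicate b false)
  rw [List.replicate_succ, List.replicate_succ']
  simpa using this

theorem rightHeavy_replicate_append {a b : ℕ} (ha : 0 < a) (hb : 0 < b) (w : List Bool) :
    RightHeavy (List.replicate a false ++ w ++ List.replicate b true) := by
  rw [← leftHeavy_dualWord]
  simpa [dualWord, Function.comp_def] using leftHeavy_replicate_append ha hb (dualWord w)

theorem leftHeavy_blockWord_of_gt {a b : ℕ} {m : List ℕ} (hm : Odd m.length)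
    (hpos : ∀ d ∈ m, 0 < d) (hab : b < a) : LeftHeavy (blockWord true (a :: (m ++ [b]))) := by
  rw [blockWord_middle _ _ _ _ hm]
  obtain rfl | ⟨m, d, rfl⟩ := List.eq_nil_or_concat' m
  · simp at hm
  -- After stripping `b` up edges from each end, `k` up edges remain in front and the last run of
  -- the middle, which goes down, is at the end.
  obtain ⟨k, rfl⟩ : ∃ k, a = b + k := ⟨a - b, by omega⟩
  have hm' : ¬ Odd m.length := by simpa [Nat.odd_add_one] using hm
  rw [List.replicate_add, List.append_assoc (List.replicate b true), (heavy_replicate_up _ _).1,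
    blockWord_append_singleton]
  simpa [hm'] using
    leftHeavy_replicate_append (show 0 < k by omega) (hpos d (by simp)) (blockWord false m)

theorem rightHeavy_blockWord_of_lt {a b : ℕ} {m : List ℕ} (hm : Odd m.length)
    (hpos : ∀ d ∈ m, 0 < d) (hab : a < b) : RightHeavy (blockWord true (a :: (m ++ [b]))) := by
  rw [blockWord_middle _ _ _ _ hm]
  rcases m with _ | ⟨d, m⟩
  · simp at hm
  obtain ⟨k, rfl⟩ : ∃ k, b = k + a := ⟨b - a, by omega⟩
  rw [List.replicate_add, ← List.append_assoc, List.append_assoc (List.replicate a true),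
    (heavy_replicate_up _ _).2, blockWord]
  exact rightHeavy_replicate_append (hpos d (by simp)) (show 0 < k by omega) _

end Compositions

/-! ### The theorem. -/

theorem mainTheorem1 {n : ℕ} (c : Composition n) :
    (c.length = 1 →
      (∀ k, k ≤ n + 1 → fenceRankSeq c k = 1) ∧ SymmetricSeq (n + 1) (fenceRankSeq c)) ∧
    (Even c.length → BottomInterlacing (n + 1) (fenceRankSeq c)) ∧
    (∀ hs : 3 ≤ c.length, Odd c.length →
      (c.blocksFun ⟨c.length - 1, by omega⟩ < c.blocksFun ⟨0, by omega⟩ →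
        BottomInterlacing (n + 1) (fenceRankSeq c)) ∧
      (c.blocksFun ⟨0, by omega⟩ < c.blocksFun ⟨c.length - 1, by omega⟩ →
        TopInterlacing (n + 1) (fenceRankSeq c)) ∧
      (c.blocksFun ⟨0, by omega⟩ = c.blocksFun ⟨c.length - 1, by omega⟩ →
        (SymmetricSeq (n + 1) (fenceRankSeq c) ↔
          SymmetricSeq (c.blocks.tail.dropLast.sum + 1) (fenceRankSeq (middleComposition c))) ∧
        (BottomInterlacing (n + 1) (fenceRankSeq c) ↔
          TopInterlacing (c.blocks.tail.dropLast.sum + 1)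
            (fenceRankSeq (middleComposition c))) ∧
        (TopInterlacing (n + 1) (fenceRankSeq c) ↔
          BottomInterlacing (c.blocks.tail.dropLast.sum + 1)
            (fenceRankSeq (middleComposition c))))) := by
  have hw := fenceRankSeq_eq_coeff c
  have hlen : (blockWord true c.blocks).length = n := by simp [c.blocks_sum]
  have hbot := bottomInterlacing_iff_leftHeavy hw
  have htop := topInterlacing_iff_rightHeavy hw
  have hsym := symmetricSeq_iff hw
  rw [hlen] at hbot htop hsym
  have hlength : c.length = c.blocks.length := rfl
  refine ⟨fun h1 => ?_, fun heven => ?_, fun hs hodd => ?_⟩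
  · have hone : ∀ k, k ≤ n + 1 → fenceRankSeq c k = 1 := by
      intro k hk
      obtain ⟨a, ha⟩ := List.length_eq_one_iff.1 h1
      have hn : a = n := by simpa [ha] using c.blocks_sum
      have := hw k
      rw [ha, hn, blockWord, blockWord, List.append_nil, fenceTotal_replicate_up n k hk] at this
      exact_mod_cast this
    exact ⟨hone, fun i hi => by rw [hone i hi, hone _ (Nat.sub_le _ _)]⟩
  · rw [hbot]
    rcases hb : c.blocks with _ | ⟨a, l⟩
    -- The empty composition also has even length; its fence is a single node.
    · exact leftHeavy_nil
    · rw [hlength, hb] at heven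
      have hpos : ∀ d ∈ a :: l, 0 < d := fun d hd => c.blocks_pos (hb ▸ hd)
      rcases List.eq_nil_or_concat' l with rfl | ⟨m, b, rfl⟩
      · simp at heven
      · have hm : ¬ Odd m.length := by
          simpa [Nat.even_add_one] using heven
        simpa [blockWord, blockWord_append_singleton, hm] using
          leftHeavy_replicate_append (hpos a (by simp)) (hpos b (by simp)) (blockWord false m)
  · obtain ⟨a, m, b, hb⟩ : ∃ a m b, c.blocks = a :: (m ++ [b]) := by
      rcases hb : c.blocks with _ | ⟨a, l⟩
      · simp [hlength, hb] at hs
      · rcases List.eq_nil_or_concat' l with rfl | ⟨m, b, rfl⟩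
        · simp [hlength, hb] at hs
        · exact ⟨a, m, b, rfl⟩
    have hm : Odd m.length := by
      simpa [hlength, hb, Nat.odd_add_one] using hodd
    have hpos : ∀ d ∈ m, 0 < d := fun d hd => c.blocks_pos (by rw [hb]; simp [hd])
    have hfirst : c.blocksFun ⟨0, by omega⟩ = a := by
      simp [Composition.blocksFun, hb]
    have hlast : c.blocksFun ⟨c.length - 1, by omega⟩ = b := by
      simp [Composition.blocksFun, hlength, hb]
    have hmid : c.blocks.tail.dropLast = m := by simp [hb]
    have hw' : ∀ k, (fenceRankSeq (middleComposition c) k : ℤ)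
        = (fenceTotal (blockWord true m)).coeff k := by
      intro k
      rw [fenceRankSeq_eq_coeff, ← hmid]
      rfl
    have hbot' := bottomInterlacing_iff_leftHeavy hw'
    have htop' := topInterlacing_iff_rightHeavy hw'
    have hsym' := symmetricSeq_iff hw'
    rw [blockWord_length, ← hmid] at hbot' htop' hsym'
    rw [hbot, htop, hsym, hbot', htop', hsym', hmid, hfirst, hlast, hb]
    refine ⟨leftHeavy_blockWord_of_gt hm hpos, rightHeavy_blockWord_of_lt hm hpos, ?_⟩
    rintro rfl
    rw [blockWord_middle _ _ _ _ hm, (heavy_replicate_up _ _).1, (heavy_replicate_up _ _).2,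
      ← dualWord_blockWord, leftHeavy_dualWord, rightHeavy_dualWord]
    exact ⟨and_comm, Iff.rfl, Iff.rfl⟩
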